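/- All Banach spaces are over $\mathbb R$ or over $\mathbb C$. A separable Banach space $X$ has the $\pi$-property if there is a sequence of bounded finite-rank linear projections $T_n:X\to X$ with $\lim_{n\to\infty}\|x-T_nx\|=0$ for every $x\in X$; it has a finite-dimensional decomposition if such a sequence can be chosen so that, in addition, $T_nT_m=T_{\min(m,n)}$ for all $n,m$. For a finite-dimensional subspace $Y$ of $X$ let $$\lambda(Y,X)=\inf\{\|P\| : P:X\to X\text{ is a bounded linear projection onto }Y\}.$$ **Theorem.** A separable Banach space $X$ has the $\pi$-property but no finite-dimensional decomposition if and only if there exists an increasing sequence $X_1\subseteq X_2\subseteq\cdots$ of finite-dimensional subspaces of $X$ such that (a) $\sup_i\lambda(X_i,X)<\infty$; (b) $\bigcup_{i=1}^\infty X_i$ is dense in $X$; (c) for every subsequence $(X_{i_n})_{n=1}^\infty$ with $i_1<i_2<\cdots$, and for every sequence of linear projections $P_n:X_{i_{n+1}}\to X_{i_n}$ onto $X_{i_n}$, $$\sup_{k<l}\|P_kP_{k+1}\cdots P_{l-1}P_l\|=\infty .$$ -/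

import Mathlib

open scoped ENNReal Topology
open Filter

namespace BanachProj

section Approximation

variable (𝕜 : Type*) [RCLike 𝕜] (E : Type*) [NormedAddCommGroup E] [NormedSpace 𝕜 E]

/-- A sequence of bounded finite-rank projections of `E` converging strongly to the identity. -/
structure IsApproxSeq (T : ℕ → E →L[𝕜] E) : Prop where
  idem : ∀ n, IsIdempotentElem (T n)
  finiteRank : ∀ n, FiniteDimensional 𝕜 (LinearMap.range (T n : E →ₗ[𝕜] E))
  tendsto : ∀ x, Tendsto (fun n => ‖x - T n x‖) atTop (𝓝 0)

/-- The `π`-property. -/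
def HasPiProperty : Prop :=
  ∃ T : ℕ → E →L[𝕜] E, IsApproxSeq 𝕜 E T

/-- Existence of a finite-dimensional decomposition. -/
def HasFDD : Prop :=
  ∃ T : ℕ → E →L[𝕜] E, IsApproxSeq 𝕜 E T ∧ ∀ n m, T n * T m = T (min m n)

end Approximation

section Projections

variable {𝕜 : Type*} [RCLike 𝕜] {E : Type*} [NormedAddCommGroup E] [NormedSpace 𝕜 E]

/-- The relative projection constant `λ(Y, E)`: the infimum of the norms of the bounded
projections of `E` onto `Y` (the value is `∞` if there are none). -/
noncomputable def relProjConst (Y : Submodule 𝕜 E) : ℝ≥0∞ :=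
  ⨅ (P : E →L[𝕜] E) (_ : LinearMap.IsProj Y P), ‖P‖ₑ

/-- For subspaces `Z ≤ Y` of `E`: the operator `P : Y → Z` is a projection of `Y` onto `Z`,
that is, it fixes every vector of `Z`. -/
def IsProjection {Y Z : Submodule 𝕜 E} (P : Y →L[𝕜] Z) : Prop :=
  ∀ y : Y, (y : E) ∈ Z → (P y : E) = y

/-- `compProj P k m` is the composition `P_k ∘ P_{k+1} ∘ ⋯ ∘ P_{k+m} : W_{k+m+1} → W_k`
of operators `P_n : W_{n+1} → W_n`. -/
noncomputable def compProj {W : ℕ → Submodule 𝕜 E} (P : ∀ n, W (n + 1) →L[𝕜] W n) (k : ℕ) :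
    ∀ m : ℕ, W (k + m + 1) →L[𝕜] W k
  | 0 => P k
  | m + 1 => (compProj P k m).comp (P (k + m + 1))

end Projections

end BanachProj

open BanachProj

/-! Both directions rest on one observation: projections onto a chain are compatible exactly when `G
n * G (n + 1) = G n`, that is, when their kernels decrease. If the `π`-property holds, small
similarities give a chain with uniformly bounded projections (`HasPiProperty.exists_chain`). Were
(c) to fail along a subsequence, the long compositions would be bounded and eventually constant on
each member, so their strong limits would be a decomposition (`hasFDD_of_compProj_bounded`).
Conversely, (a) and (b) give the `π`-property. A decomposition `T` would yield uniformly bounded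
projections `G` onto members of the chain with `ker T m' ≤ ker G ≤ ker T m`
(`exists_interlacing_proj`). Interlacing makes the kernels decrease, so compositions of the
restricted `G n` collapse to the first factor and stay bounded, against (c). -/

namespace BanachProj

/-! ### Algebra of idempotents with prescribed kernels and ranges -/

section Ring

variable {R : Type*} [Ring R]

/-- If `A = 1 + (Q - 1) T` is invertible, the idempotent `H = A T A⁻¹` has the kernel of `T`, and
its range lies in the range of `Q`. -/
theorem exists_proj_same_ker {T Q A B : R} (hT : T * T = T) (hQ : Q * Q = Q)
    (hA : A = 1 + (Q - 1) * T) (hAB : A * B = 1) (hBA : B * A = 1) :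
    T * (Q * T * B) = T ∧ Q * (Q * T * B) = Q * T * B ∧
      Q * T * B * (Q * T * B) = Q * T * B := by
  have hAT : A * T = Q * T := by
    rw [hA, add_mul, mul_assoc, hT]; noncomm_ring
  have hA1 : A * (1 - T) = 1 - T := by
    rw [hA, add_mul, mul_assoc, mul_sub T, hT]; simp
  have h1 : 1 - Q * T * B = (1 - T) * B := by
    calc 1 - Q * T * B = A * B - A * T * B := by rw [hAB, hAT]
      _ = A * (1 - T) * B := by noncomm_ring
      _ = _ := by rw [hA1]
  refine ⟨?_, ?_, ?_⟩
  · have : T * (1 - Q * T * B) = 0 := by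
      rw [h1, ← mul_assoc, mul_sub, hT]; simp
    rw [mul_sub, mul_one, sub_eq_zero] at this
    exact this.symm
  · rw [← mul_assoc, ← mul_assoc, hQ]
  · calc Q * T * B * (Q * T * B) = A * T * (B * A) * T * B := by rw [← hAT]; noncomm_ring
      _ = A * (T * T) * B := by rw [hBA]; noncomm_ring
      _ = Q * T * B := by rw [hT, hAT]

/-- Correcting a projection `Q` by an operator `H` with range in the range of `Q`. -/
theorem proj_correction {T Q H : R} (hQ : Q * Q = Q) (hTH : T * H = T) (hQH : Q * H = H)
    (hH : H * H = H) :
    Q * (H + (1 - H) * Q * (1 - H)) = H + (1 - H) * Q * (1 - H) ∧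
    (H + (1 - H) * Q * (1 - H)) * Q = Q ∧
    T * (H + (1 - H) * Q * (1 - H)) = T := by
  have h1 : Q * ((1 - H) * Q) = (1 - H) * Q := by
    calc Q * ((1 - H) * Q) = Q * Q - Q * H * Q := by noncomm_ring
      _ = _ := by rw [hQ, hQH]; noncomm_ring
  refine ⟨?_, ?_, ?_⟩
  · rw [mul_add, hQH, ← mul_assoc, h1]
  · rw [add_mul, mul_assoc ((1 - H) * Q), mul_assoc (1 - H) Q, h1]
    calc H * Q + (1 - H) * ((1 - H) * Q) = Q - H * Q + H * H * Q := by noncomm_ring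
      _ = Q := by rw [hH]; noncomm_ring
  · have : T * (1 - H) = 0 := by rw [mul_sub, hTH]; simp
    rw [mul_add, hTH, ← mul_assoc, ← mul_assoc, this]; simp

/-- If `V = 1 - G + G T' G` is invertible, the idempotent `V⁻¹ G T'` has the range of `G`. -/
theorem proj_compression {T T' Q G V W : R} (hT' : T' * T' = T') (hTT' : T * T' = T)
    (hQG : Q * G = G) (hGQ : G * Q = Q) (hTG : T * G = T)
    (hV : V = 1 - G + G * T' * G) (hVW : V * W = 1) (hWV : W * V = 1) :
    T * (W * G * T') = T ∧ (W * G * T') * T' = W * G * T' ∧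
      Q * (W * G * T') = W * G * T' ∧ (W * G * T') * Q = Q := by
  have hG : G * G = G := by
    calc G * G = G * (Q * G) := by rw [hQG]
      _ = G := by rw [← mul_assoc, hGQ, hQG]
  have hVG : V * G = G * T' * G := by
    rw [hV, add_mul, sub_mul, hG, mul_assoc, hG]; simp
  have hGV : G * V = G * T' * G := by
    rw [hV, mul_add, mul_sub, hG, ← mul_assoc, ← mul_assoc, hG]; simp
  have hWG : W * G = G * W := by
    calc W * G = W * (G * V) * W := by rw [mul_assoc, mul_assoc, hVW, mul_one]
      _ = W * V * G * W := by rw [hGV, ← hVG, mul_assoc W V G]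
      _ = G * W := by rw [hWV, one_mul]
  have hTV : T * V = T := by
    rw [hV, mul_add, mul_sub, ← mul_assoc, ← mul_assoc, hTG, hTT', hTG]; simp
  have hTW : T * W = T := by
    calc T * W = T * V * W := by rw [hTV]
      _ = T := by rw [mul_assoc, hVW, mul_one]
  refine ⟨?_, ?_, ?_, ?_⟩
  · rw [← mul_assoc, ← mul_assoc, hTW, hTG, hTT']
  · rw [mul_assoc, hT']
  · rw [hWG, ← mul_assoc, ← mul_assoc, hQG]
  · calc W * G * T' * Q = W * (G * T' * G) * Q := by
          conv_lhs => rw [← hGQ]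
          noncomm_ring
      _ = W * V * (G * Q) := by rw [← hVG]; noncomm_ring
      _ = Q := by rw [hWV, one_mul, hGQ]

end Ring

/-! ### Perturbation, strong convergence and projection constants -/

section Operators

variable {𝕜 : Type*} [RCLike 𝕜] {E : Type*} [NormedAddCommGroup E] [NormedSpace 𝕜 E]

theorem norm_one_sub_le (H : E →L[𝕜] E) : ‖1 - H‖ ≤ 1 + ‖H‖ :=
  (norm_sub_le _ _).trans (by gcongr; exact ContinuousLinearMap.norm_id_le)

/-- An operator at distance at most `1 / 2` from the identity is invertible. -/
theorem exists_inverse_of_near_one [CompleteSpace E] {A : E →L[𝕜] E} (h : ‖A - 1‖ ≤ 1 / 2) :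
    ∃ B : E →L[𝕜] E, A * B = 1 ∧ B * A = 1 ∧ ‖B‖ ≤ 2 := by
  have hlt : ‖1 - A‖ < 1 := by rw [norm_sub_rev]; linarith
  obtain ⟨u, hu⟩ : IsUnit A := by
    have := isUnit_one_sub_of_norm_lt_one hlt
    simpa using this
  have h1 : A * (↑u⁻¹ : E →L[𝕜] E) = 1 := by rw [← hu]; simp
  refine ⟨(↑u⁻¹ : E →L[𝕜] E), h1, by rw [← hu]; simp, ?_⟩
  refine ContinuousLinearMap.opNorm_le_bound _ (by norm_num) fun x => ?_
  set y := (↑u⁻¹ : E →L[𝕜] E) x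
  have hy : A y = x := by
    have := congrArg (fun S : E →L[𝕜] E => S x) h1
    simpa using this
  have h2 : ‖(A - 1) y‖ ≤ 1 / 2 * ‖y‖ := (A - 1).le_of_opNorm_le h y
  have h3 : y = x - (A - 1) y := by simp [hy]
  have h4 : ‖y‖ ≤ ‖x‖ + ‖(A - 1) y‖ := by
    conv_lhs => rw [h3]
    exact norm_sub_le _ _
  linarith

/-- Strong convergence to the identity is uniform on a finite-dimensional subspace. -/
theorem tendsto_norm_sub_one_mul {T : ℕ → E →L[𝕜] E} (hT : ∀ x, Tendsto (fun n => T n x) atTop (𝓝 x))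
    (Y : Submodule 𝕜 E) [FiniteDimensional 𝕜 Y] {R : E →L[𝕜] E} (hR : ∀ x, R x ∈ Y) :
    Tendsto (fun n => ‖(T n - 1) * R‖) atTop (𝓝 0) := by
  let b := Module.finBasis 𝕜 Y
  obtain ⟨C, hC, hb⟩ := b.exists_opNorm_le (F := E)
  let u : ℕ → Y →L[𝕜] E := fun n => (T n - 1).comp Y.subtypeL
  have hu : Tendsto (fun n => C * ∑ i, ‖u n (b i)‖) atTop (𝓝 0) := by
    have : Tendsto (fun n => C * ∑ i, ‖u n (b i)‖) atTop (𝓝 (C * ∑ _i : Fin (Module.finrank 𝕜 Y), (0 : ℝ))) := by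
      refine Tendsto.const_mul _ (tendsto_finsetSum _ fun i _ => ?_)
      have := (tendsto_iff_norm_sub_tendsto_zero.1 (hT (b i)))
      simpa [u] using this
    simpa using this
  have hle : ∀ n, ‖u n‖ ≤ C * ∑ i, ‖u n (b i)‖ := fun n =>
    hb (Finset.sum_nonneg fun i _ => norm_nonneg _) fun i =>
      Finset.single_le_sum (f := fun i => ‖u n (b i)‖) (fun i _ => norm_nonneg _) (Finset.mem_univ i)
  have hu' : Tendsto (fun n => (C * ∑ i, ‖u n (b i)‖) * ‖R‖) atTop (𝓝 0) := by
    simpa using hu.mul_const ‖R‖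
  refine squeeze_zero (fun n => norm_nonneg _) (fun n => ?_) hu'
  refine ContinuousLinearMap.opNorm_le_bound _
    (mul_nonneg ((norm_nonneg _).trans (hle n)) (norm_nonneg _)) fun x => ?_
  calc ‖((T n - 1) * R) x‖ = ‖u n ⟨R x, hR x⟩‖ := rfl
    _ ≤ ‖u n‖ * ‖R x‖ := (u n).le_opNorm _
    _ ≤ (C * ∑ i, ‖u n (b i)‖) * (‖R‖ * ‖x‖) := by
        exact mul_le_mul (hle n) (R.le_opNorm x) (norm_nonneg _) ((norm_nonneg _).trans (hle n))
    _ = _ := by ring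

theorem IsApproxSeq.tendsto_apply {T : ℕ → E →L[𝕜] E} (hT : IsApproxSeq 𝕜 E T) (x : E) :
    Tendsto (fun n => T n x) atTop (𝓝 x) := by
  rw [tendsto_iff_norm_sub_tendsto_zero]
  simpa only [norm_sub_rev] using hT.tendsto x

theorem IsApproxSeq.exists_bound [CompleteSpace E] {T : ℕ → E →L[𝕜] E}
    (hT : IsApproxSeq 𝕜 E T) : ∃ C, 0 ≤ C ∧ ∀ n, ‖T n‖ ≤ C := by
  obtain ⟨C, hC⟩ := banach_steinhaus (g := T) fun x => by
    obtain ⟨C, hC⟩ := (hT.tendsto_apply x).norm.bddAbove_range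
    exact ⟨C, fun i => hC ⟨i, rfl⟩⟩
  exact ⟨C, (norm_nonneg _).trans (hC 0), hC⟩

theorem isProj_mul_self {Y : Submodule 𝕜 E} {P : E →L[𝕜] E} (hP : LinearMap.IsProj Y P) :
    P * P = P := by
  ext x
  exact hP.map_id _ (hP.map_mem x)

theorem isProj_range {P : E →L[𝕜] E} (hP : P * P = P) :
    LinearMap.IsProj (LinearMap.range (P : E →ₗ[𝕜] E)) P where
  map_mem x := ⟨x, rfl⟩
  map_id := by
    rintro _ ⟨x, rfl⟩
    exact congrArg (fun S : E →L[𝕜] E => S x) hP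

theorem isProj_of_mul {Y : Submodule 𝕜 E} {P G : E →L[𝕜] E} (hP : LinearMap.IsProj Y P)
    (h1 : P * G = G) (h2 : G * P = P) : LinearMap.IsProj Y G where
  map_mem x := by
    rw [← h1]
    exact hP.map_mem _
  map_id x hx := by
    have := congrArg (fun S : E →L[𝕜] E => S x) h2
    simpa [hP.map_id x hx] using this

theorem isProj_finiteRank {Y : Submodule 𝕜 E} [FiniteDimensional 𝕜 Y] {P : E →L[𝕜] E}
    (hP : LinearMap.IsProj Y P) : FiniteDimensional 𝕜 (LinearMap.range (P : E →ₗ[𝕜] E)) := by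
  refine Submodule.finiteDimensional_of_le (S₂ := Y) ?_
  rintro _ ⟨x, rfl⟩
  exact hP.map_mem x

/-- Uniformly bounded operators converging to the identity on a dense set converge strongly. -/
theorem tendsto_apply_of_dense {T : ℕ → E →L[𝕜] E} {C : ℝ} (hC : ∀ n, ‖T n‖ ≤ C) {s : Set E}
    (hs : Dense s) (h : ∀ x ∈ s, ∀ᶠ n in atTop, T n x = x) (x : E) :
    Tendsto (fun n => T n x) atTop (𝓝 x) := by
  have hC0 : 0 ≤ C := (norm_nonneg _).trans (hC 0)
  rw [Metric.tendsto_nhds]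
  intro ε hε
  obtain ⟨y, hy, hxy⟩ := hs.exists_dist_lt x (ε := ε / (C + 1)) (by positivity)
  filter_upwards [h y hy] with n hn
  have h1 : T n x - x = T n (x - y) + (y - x) := by rw [map_sub, hn]; abel
  rw [dist_eq_norm] at hxy ⊢
  calc ‖T n x - x‖ ≤ ‖T n (x - y)‖ + ‖y - x‖ := by rw [h1]; exact norm_add_le _ _
    _ ≤ C * ‖x - y‖ + ‖x - y‖ := by
        rw [norm_sub_rev y x]
        gcongr
        exact (T n).le_of_opNorm_le (hC n) _
    _ = (C + 1) * ‖x - y‖ := by ring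
    _ < (C + 1) * (ε / (C + 1)) := by gcongr
    _ = ε := by field_simp

theorem isApproxSeq_of_isProj {X : ℕ → Submodule 𝕜 E} (hmono : Monotone X)
    (hfin : ∀ i, FiniteDimensional 𝕜 (X i)) (hdense : Dense (⋃ i, (X i : Set E)))
    {Q : ℕ → E →L[𝕜] E} (hQ : ∀ i, LinearMap.IsProj (X i) (Q i)) {C : ℝ} (hC : ∀ i, ‖Q i‖ ≤ C) :
    IsApproxSeq 𝕜 E Q where
  idem i := isProj_mul_self (hQ i)
  finiteRank i := isProj_finiteRank (hQ i)
  tendsto x := by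
    have h := tendsto_apply_of_dense hC hdense (fun y hy => by
      obtain ⟨i, hi⟩ := Set.mem_iUnion.1 hy
      filter_upwards [eventually_ge_atTop i] with n hn
      exact (hQ n).map_id y (hmono hn hi)) x
    rw [tendsto_iff_norm_sub_tendsto_zero] at h
    simpa only [norm_sub_rev] using h

theorem exists_isProj_of_relProjConst {X : ℕ → Submodule 𝕜 E}
    (h : (⨆ i, relProjConst (X i)) < ∞) :
    ∃ (Q : ℕ → E →L[𝕜] E) (C : ℝ), (∀ i, LinearMap.IsProj (X i) (Q i)) ∧ ∀ i, ‖Q i‖ ≤ C := by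
  -- The infimum need not be attained; a finite `c` strictly above the supremum leaves room for an
  -- actual projection at every `i`.
  obtain ⟨c, hc, hc'⟩ := exists_between h
  have key : ∀ i, ∃ P : E →L[𝕜] E, LinearMap.IsProj (X i) P ∧ ‖P‖ ≤ c.toReal := by
    intro i
    have h1 : relProjConst (X i) < c := (le_iSup (fun i => relProjConst (X i)) i).trans_lt hc
    simp only [relProjConst, iInf_lt_iff] at h1
    obtain ⟨P, hP, hlt⟩ := h1
    refine ⟨P, hP, ?_⟩
    have := ENNReal.toReal_mono hc'.ne hlt.le
    simpa using this
  choose Q hQ hQ' using key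
  exact ⟨Q, _, hQ, hQ'⟩

theorem iSup_relProjConst_lt_top {X : ℕ → Submodule 𝕜 E} {Q : ℕ → E →L[𝕜] E} {C : ℝ}
    (hQ : ∀ i, LinearMap.IsProj (X i) (Q i)) (hC : ∀ i, ‖Q i‖ ≤ C) :
    (⨆ i, relProjConst (X i)) < ∞ := by
  refine lt_of_le_of_lt (iSup_le fun i => ?_) (ENNReal.ofReal_lt_top (r := C))
  refine (iInf₂_le (Q i) (hQ i)).trans ?_
  rw [← ofReal_norm]
  exact ENNReal.ofReal_le_ofReal (hC i)

end Operators

/-! ### From a decomposition to bounded compositions along a subchain -/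

section Chains

variable {𝕜 : Type*} [RCLike 𝕜] {E : Type*} [NormedAddCommGroup E] [NormedSpace 𝕜 E]
  [CompleteSpace E]

/-- Given a finite-dimensional decomposition `T` and bounded projections `Q` onto the members of a
chain, one finds uniformly bounded projections onto members of the chain whose kernels lie between
those of two members of `T`. -/
theorem exists_interlacing_proj {T Q : ℕ → E →L[𝕜] E} {X : ℕ → Submodule 𝕜 E}
    (hT : IsApproxSeq 𝕜 E T) (hTT : ∀ n m, T n * T m = T (min m n))
    [∀ i, FiniteDimensional 𝕜 (X i)] (hQX : ∀ i, LinearMap.IsProj (X i) (Q i))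
    (hQ : IsApproxSeq 𝕜 E Q) :
    ∃ M : ℝ, ∀ i m, ∃ i' m', ∃ G : E →L[𝕜] E, i < i' ∧ LinearMap.IsProj (X i') G ∧
      T m * G = T m ∧ G * T m' = G ∧ ‖G‖ ≤ M := by
  obtain ⟨C, hC0, hC⟩ := hT.exists_bound
  obtain ⟨L, hL0, hL⟩ := hQ.exists_bound
  -- The inner bracket bounds the corrected projection; the outer factors bound `W` and `T m'`.
  -- Nothing depends on `i` or `m`.
  refine ⟨2 * (L * C * 2 + (1 + L * C * 2) * L * (1 + L * C * 2)) * C, fun i m => ?_⟩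
  have hTm : T m * T m = T m := hT.idem m
  have := hT.finiteRank m
  have h1 := tendsto_norm_sub_one_mul hQ.tendsto_apply
    (LinearMap.range (T m : E →ₗ[𝕜] E)) (R := T m) (fun x => ⟨x, rfl⟩)
  obtain ⟨i', hi', hii'⟩ := ((h1.eventually_le_const (u := 1 / 2) (by norm_num)).and
    (eventually_gt_atTop i)).exists
  have hQi : Q i' * Q i' = Q i' := hQ.idem i'
  obtain ⟨B, hAB, hBA, hB⟩ := exists_inverse_of_near_one (A := 1 + (Q i' - 1) * T m)
    (by simpa using hi')
  obtain ⟨hTH, hQH, hHH⟩ := exists_proj_same_ker hTm hQi rfl hAB hBA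
  have hH : ‖Q i' * T m * B‖ ≤ L * C * 2 :=
    (norm_mul_le _ _).trans (mul_le_mul ((norm_mul_le _ _).trans
      (mul_le_mul (hL _) (hC _) (norm_nonneg _) hL0)) hB (norm_nonneg _) (by positivity))
  generalize Q i' * T m * B = H at *
  obtain ⟨hQG, hGQ, hTG⟩ := proj_correction hQi hTH hQH hHH
  have hH1 : ‖1 - H‖ ≤ 1 + L * C * 2 := (norm_one_sub_le H).trans (by linarith)
  have hG : ‖H + (1 - H) * Q i' * (1 - H)‖ ≤
      L * C * 2 + (1 + L * C * 2) * L * (1 + L * C * 2) :=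
    (norm_add_le _ _).trans (add_le_add hH ((norm_mul_le _ _).trans
      (mul_le_mul ((norm_mul_le _ _).trans (mul_le_mul hH1 (hL _) (norm_nonneg _) (by positivity)))
        hH1 (norm_nonneg _) (by positivity))))
  generalize H + (1 - H) * Q i' * (1 - H) = G at *
  have hGX : LinearMap.IsProj (X i') G := isProj_of_mul (hQX i') hQG hGQ
  have h2 := (tendsto_norm_sub_one_mul hT.tendsto_apply (X i') hGX.map_mem).const_mul ‖G‖
  rw [mul_zero] at h2
  -- `m'` is chosen after `G`, so that `T m'` is close to the identity on its range.
  obtain ⟨m', hm', hmm'⟩ := ((h2.eventually_le_const (u := 1 / 2) (by norm_num)).and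
    (eventually_ge_atTop m)).exists
  obtain ⟨W, hVW, hWV, hW⟩ := exists_inverse_of_near_one (A := 1 - G + G * T m' * G) (by
    have : 1 - G + G * T m' * G - 1 = G * ((T m' - 1) * G) := by
      calc 1 - G + G * T m' * G - 1 = G * T m' * G - G := by abel
        _ = G * T m' * G - G * G := by rw [isProj_mul_self hGX]
        _ = _ := by noncomm_ring
    rw [this]
    exact (norm_mul_le _ _).trans hm')
  obtain ⟨k1, k2, k3, k4⟩ := proj_compression (T := T m) (T' := T m') (Q := Q i') (G := G)
    (hT.idem m') (by rw [hTT, min_eq_right hmm']) hQG hGQ hTG rfl hVW hWV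
  refine ⟨i', m', W * G * T m', hii', isProj_of_mul (hQX i') k3 k4, k1, k2, ?_⟩
  have hG0 := (norm_nonneg _).trans hG
  exact (norm_mul_le _ _).trans (mul_le_mul ((norm_mul_le _ _).trans
    (mul_le_mul hW hG (norm_nonneg _) (by norm_num))) (hC _) (norm_nonneg _) (by positivity))

/-- The upper index `m'` of one interlacing step is the lower index of the next, so a common `T m'`
separates consecutive kernels. -/
theorem exists_nested_proj_of_hasFDD (hE : HasFDD 𝕜 E) {Q : ℕ → E →L[𝕜] E}
    {X : ℕ → Submodule 𝕜 E} [∀ i, FiniteDimensional 𝕜 (X i)]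
    (hQX : ∀ i, LinearMap.IsProj (X i) (Q i)) (hQ : IsApproxSeq 𝕜 E Q) :
    ∃ (φ : ℕ → ℕ) (G : ℕ → E →L[𝕜] E) (M : ℝ), StrictMono φ ∧
      (∀ n, LinearMap.IsProj (X (φ n)) (G n)) ∧ (∀ n, G n * G (n + 1) = G n) ∧
      ∀ n, ‖G n‖ ≤ M := by
  obtain ⟨T, hT, hTT⟩ := hE
  obtain ⟨M, hM⟩ := exists_interlacing_proj hT hTT hQX hQ
  choose a b g h1 h2 h3 h4 h5 using hM
  let s : ℕ → ℕ × ℕ := fun n => Nat.rec (0, 0) (fun _ p => (a p.1 p.2, b p.1 p.2)) n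
  refine ⟨fun n => (s (n + 1)).1, fun n => g (s n).1 (s n).2, M,
    strictMono_nat_of_lt_succ fun n => h1 _ _, fun n => h2 _ _, fun n => ?_, fun n => h5 _ _⟩
  have e1 : g (s n).1 (s n).2 * T (s (n + 1)).2 = g (s n).1 (s n).2 := h4 _ _
  have e2 : T (s (n + 1)).2 * g (s (n + 1)).1 (s (n + 1)).2 = T (s (n + 1)).2 := h3 _ _
  calc g (s n).1 (s n).2 * g (s (n + 1)).1 (s (n + 1)).2
      = g (s n).1 (s n).2 * T (s (n + 1)).2 * g (s (n + 1)).1 (s (n + 1)).2 := by rw [e1]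
    _ = g (s n).1 (s n).2 := by rw [mul_assoc, e2, e1]

omit [CompleteSpace E] in
theorem mul_eq_left_of_le {G : ℕ → E →L[𝕜] E} (h : ∀ n, G n * G (n + 1) = G n) {k l : ℕ}
    (hk : G k * G k = G k) (hkl : k ≤ l) : G k * G l = G k := by
  induction l, hkl using Nat.le_induction with
  | base => exact hk
  | succ n _ ih => rw [← ih, mul_assoc, h]

omit [CompleteSpace E] in
theorem compProj_eq_of_nested {W : ℕ → Submodule 𝕜 E} {G : ℕ → E →L[𝕜] E}
    (hG : ∀ n, LinearMap.IsProj (W n) (G n)) (h : ∀ n, G n * G (n + 1) = G n)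
    {P : ∀ n, W (n + 1) →L[𝕜] W n} (hP : ∀ n y, (P n y : E) = G n y) (k m : ℕ)
    (y : W (k + m + 1)) : (compProj P k m y : E) = G k y := by
  induction m with
  | zero => exact hP k y
  | succ m ih =>
    have h1 : (compProj P k (m + 1) y : E) = G k (P (k + m + 1) y) := ih _
    rw [h1, hP]
    exact congrArg (fun S : E →L[𝕜] E => S y)
      (mul_eq_left_of_le h (isProj_mul_self (hG k)) (by omega : k ≤ k + m + 1))

/-- Restrictions of nested projections telescope to a restriction of `G k`, so the uniform bound on
`G` contradicts `h`. -/
theorem not_hasFDD_of_chain {X : ℕ → Submodule 𝕜 E} {Q : ℕ → E →L[𝕜] E}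
    [∀ i, FiniteDimensional 𝕜 (X i)]
    (hQX : ∀ i, LinearMap.IsProj (X i) (Q i)) (hQ : IsApproxSeq 𝕜 E Q)
    (h : ∀ φ : ℕ → ℕ, StrictMono φ →
      ∀ P : ∀ n, X (φ (n + 1)) →L[𝕜] X (φ n), (∀ n, IsProjection (P n)) →
        (⨆ (k : ℕ) (l : ℕ) (_ : k < l),
          ‖compProj (W := fun n => X (φ n)) P k (l - k)‖ₑ) = ∞) :
    ¬ HasFDD 𝕜 E := by
  intro hE
  obtain ⟨φ, G, M, hφ, hG, hGG, hM⟩ := exists_nested_proj_of_hasFDD hE hQX hQ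
  let P : ∀ n, X (φ (n + 1)) →L[𝕜] X (φ n) := fun n =>
    ((G n).comp (X (φ (n + 1))).subtypeL).codRestrict (X (φ n)) fun y => (hG n).map_mem y
  have hinf := h φ hφ P fun n y hy => (hG n).map_id y hy
  refine (lt_of_le_of_lt ?_ (ENNReal.ofReal_lt_top (r := M))).ne hinf
  refine iSup_le fun k => iSup₂_le fun l _ => ?_
  rw [← ofReal_norm]
  refine ENNReal.ofReal_le_ofReal (ContinuousLinearMap.opNorm_le_bound _
    ((norm_nonneg _).trans (hM 0)) fun y => ?_)
  have hc := compProj_eq_of_nested (W := fun n => X (φ n)) hG hGG (P := P) (fun n y => rfl) k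
    (l - k) y
  rw [Submodule.coe_norm, hc]
  exact (G k).le_of_opNorm_le (hM k) _

end Chains

/-! ### Building decompositions and chains -/

section Construction

variable {𝕜 : Type*} [RCLike 𝕜] {E : Type*} [NormedAddCommGroup E] [NormedSpace 𝕜 E]

/-- Uniformly bounded operators that are eventually constant on a dense set converge strongly. -/
theorem exists_strong_limit [CompleteSpace E] {g : ℕ → E →L[𝕜] E} {C : ℝ} (hC : ∀ n, ‖g n‖ ≤ C)
    {s : Set E} (hs : Dense s) (h : ∀ x ∈ s, ∃ y, ∀ᶠ n in atTop, g n x = y) :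
    ∃ S : E →L[𝕜] E, (∀ x, Tendsto (fun n => g n x) atTop (𝓝 (S x))) ∧ ‖S‖ ≤ C := by
  have hC0 : 0 ≤ C := (norm_nonneg _).trans (hC 0)
  have key : ∀ x, ∃ y, Tendsto (fun n => g n x) atTop (𝓝 y) := by
    intro x
    refine cauchySeq_tendsto_of_complete (Metric.cauchySeq_iff.2 fun ε hε => ?_)
    obtain ⟨z, hz, hxz⟩ := hs.exists_dist_lt x (ε := ε / (2 * C + 1)) (by positivity)
    obtain ⟨y, hy⟩ := h z hz
    obtain ⟨N, hN⟩ := eventually_atTop.1 hy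
    refine ⟨N, fun m hm n hn => ?_⟩
    have h1 : g m x - g n x = g m (x - z) - g n (x - z) := by
      rw [map_sub, map_sub, hN m hm, hN n hn]; abel
    rw [dist_eq_norm] at hxz ⊢
    calc ‖g m x - g n x‖ ≤ ‖g m (x - z)‖ + ‖g n (x - z)‖ := by rw [h1]; exact norm_sub_le _ _
      _ ≤ C * ‖x - z‖ + C * ‖x - z‖ :=
          add_le_add ((g m).le_of_opNorm_le (hC m) _) ((g n).le_of_opNorm_le (hC n) _)
      _ ≤ (2 * C + 1) * ‖x - z‖ := by nlinarith [norm_nonneg (x - z)]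
      _ < (2 * C + 1) * (ε / (2 * C + 1)) := by gcongr
      _ = ε := by field_simp
  choose f hf using key
  refine ⟨continuousLinearMapOfTendsto g (tendsto_pi_nhds.2 hf), hf, ?_⟩
  refine ContinuousLinearMap.opNorm_le_bound _ hC0 fun x => ?_
  exact le_of_tendsto (hf x).norm (Eventually.of_forall fun n => (g n).le_of_opNorm_le (hC n) x)

/-- `iterProd p k m` is the product `p k * p (k + 1) * ⋯ * p (k + m)`. -/
def iterProd {R : Type*} [Mul R] (p : ℕ → R) (k : ℕ) : ℕ → R
  | 0 => p k
  | m + 1 => iterProd p k m * p (k + m + 1)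

/-- Splitting off the leftmost factor shows where the product takes its values and relates products
starting at `k` and `k + 1`. -/
theorem iterProd_succ_left {R : Type*} [Semigroup R] (p : ℕ → R) (k m : ℕ) :
    iterProd p k (m + 1) = p k * iterProd p (k + 1) m := by
  induction m with
  | zero => rfl
  | succ m ih =>
    rw [iterProd, ih, iterProd, mul_assoc]
    congr 3
    omega

theorem iterProd_apply_eq_compProj {W : ℕ → Submodule 𝕜 E} {P : ∀ n, W (n + 1) →L[𝕜] W n}
    {p : ℕ → E →L[𝕜] E} (hp : ∀ n (y : W (n + 1)), p n y = P n y) (k m : ℕ)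
    (y : W (k + m + 1)) : iterProd p k m y = compProj P k m y := by
  induction m with
  | zero => exact hp k y
  | succ m ih =>
    have h1 : iterProd p k (m + 1) y = iterProd p k m (p (k + m + 1) y) := rfl
    rw [h1, hp (k + m + 1) y]
    exact ih (P (k + m + 1) y)

/-- Projections between consecutive members of a chain whose compositions are uniformly bounded
give rise to a finite-dimensional decomposition. -/
theorem hasFDD_of_compProj_bounded [CompleteSpace E] {W : ℕ → Submodule 𝕜 E} (hmono : Monotone W)
    [∀ i, FiniteDimensional 𝕜 (W i)] (hdense : Dense (⋃ i, (W i : Set E)))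
    {Q : ℕ → E →L[𝕜] E} (hQ : ∀ i, LinearMap.IsProj (W i) (Q i)) {C : ℝ} (hC : ∀ i, ‖Q i‖ ≤ C)
    {P : ∀ n, W (n + 1) →L[𝕜] W n} (hP : ∀ n, IsProjection (P n)) {M : ℝ} (hM0 : 0 ≤ M)
    (hM : ∀ k m, ‖compProj P k (m + 1)‖ ≤ M) : HasFDD 𝕜 E := by
  have hC0 : 0 ≤ C := (norm_nonneg _).trans (hC 0)
  -- Precomposing with `Q (n + 1)` extends `P n` to all of `E`, so that every product lives in one
  -- ring.
  let p : ℕ → E →L[𝕜] E := fun n => (W n).subtypeL.comp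
    ((P n).comp ((Q (n + 1)).codRestrict (W (n + 1)) (hQ (n + 1)).map_mem))
  have hpP : ∀ n (y : W (n + 1)), p n y = P n y := fun n y => by
    have : (Q (n + 1)).codRestrict (W (n + 1)) (hQ (n + 1)).map_mem y = y :=
      Subtype.ext ((hQ (n + 1)).map_id _ y.2)
    simp only [p, ContinuousLinearMap.comp_apply, this, Submodule.subtypeL_apply]
  have hpQ : ∀ n, p n * Q (n + 1) = p n := fun n => by
    ext x
    have : (Q (n + 1)).codRestrict (W (n + 1)) (hQ (n + 1)).map_mem (Q (n + 1) x) =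
        (Q (n + 1)).codRestrict (W (n + 1)) (hQ (n + 1)).map_mem x :=
      Subtype.ext ((hQ (n + 1)).map_id _ ((hQ (n + 1)).map_mem x))
    simp only [p, mul_apply_eq_comp, ContinuousLinearMap.comp_apply, this]
  have hpW : ∀ n x, p n x ∈ W n := fun n x => Subtype.prop _
  have hpid : ∀ n, ∀ x ∈ W n, p n x = x := fun n x hx => by
    have := hP n ⟨x, hmono n.le_succ hx⟩ hx
    rw [← hpP] at this
    exact this
  have hstep : ∀ k m, ∀ x ∈ W (k + m + 1), iterProd p k (m + 1) x = iterProd p k m x :=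
    fun k m x hx => by
      change iterProd p k m (p (k + m + 1) x) = _
      rw [hpid _ x hx]
  have hstab : ∀ k m, ∀ x ∈ W (k + m + 1), ∀ m' ≥ m, iterProd p k m' x = iterProd p k m x := by
    intro k m x hx m' hm'
    induction m', hm' using Nat.le_induction with
    | base => rfl
    | succ j hj ih => rw [hstep k j x (hmono (by omega) hx), ih]
  -- The rightmost factor absorbs its `Q`, so the extension costs `C` only once, whatever the
  -- length.
  have hbound : ∀ k m, ‖iterProd p k (m + 1)‖ ≤ M * C := by
    intro k m
    refine ContinuousLinearMap.opNorm_le_bound _ (by positivity) fun x => ?_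
    have h1 : iterProd p k (m + 1) x = iterProd p k (m + 1) (Q (k + (m + 1) + 1) x) := by
      change iterProd p k m (p (k + m + 1) x) =
        iterProd p k m ((p (k + m + 1) * Q (k + m + 1 + 1)) x)
      rw [hpQ]
    rw [h1, iterProd_apply_eq_compProj hpP k (m + 1) ⟨_, (hQ (k + (m + 1) + 1)).map_mem x⟩,
      ← Submodule.coe_norm, mul_assoc]
    refine (ContinuousLinearMap.le_of_opNorm_le _ (hM k m) _).trans ?_
    gcongr
    exact (Q _).le_of_opNorm_le (hC _) x
  have hlim := fun k => exists_strong_limit (hbound k) hdense fun x hx => by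
    obtain ⟨N, hN⟩ := Set.mem_iUnion.1 hx
    refine ⟨iterProd p k N x, eventually_atTop.2 ⟨N, fun n hn => ?_⟩⟩
    exact hstab k N x (hmono (by omega) hN) _ (by omega)
  choose S hS hSb using hlim
  have hSeq : ∀ k m, ∀ x ∈ W (k + m + 1), S k x = iterProd p k m x := fun k m x hx =>
    tendsto_nhds_unique (hS k x) (tendsto_const_nhds.congr' (eventually_atTop.2
      ⟨m, fun n hn => (hstab k m x hx _ (by omega)).symm⟩))
  have hprodW : ∀ k m x, iterProd p k m x ∈ W k := by
    intro k m x
    cases m with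
    | zero => exact hpW k x
    | succ m => rw [iterProd_succ_left]; exact hpW k _
  have hSproj : ∀ k, LinearMap.IsProj (W k) (S k) := fun k =>
    { map_mem := fun x => (W k).closed_of_finiteDimensional.mem_of_tendsto (hS k x)
        (Eventually.of_forall fun n => hprodW _ _ _)
      map_id := fun x hx => by
        rw [hSeq k 0 x (hmono (by omega) hx)]
        exact hpid k x hx }
  have hnest : ∀ k, S k * S (k + 1) = S k := by
    intro k
    refine ContinuousLinearMap.coeFn_injective
      (Continuous.ext_on hdense (S k * S (k + 1)).continuous (S k).continuous fun x hx => ?_)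
    obtain ⟨N, hN⟩ := Set.mem_iUnion.1 hx
    rw [hSeq k (N + 1) x (hmono (by omega) hN), iterProd_succ_left]
    change S k (S (k + 1) x) = p k (iterProd p (k + 1) N x)
    rw [hSeq (k + 1) N x (hmono (by omega) hN)]
    exact hSeq k 0 _ (hprodW _ _ _)
  refine ⟨S, isApproxSeq_of_isProj hmono inferInstance hdense hSproj hSb, fun n m => ?_⟩
  rcases le_total n m with hnm | hmn
  · rw [min_eq_right hnm]
    exact mul_eq_left_of_le hnest (isProj_mul_self (hSproj n)) hnm
  · rw [min_eq_left hmn]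
    ext x
    exact (hSproj n).map_id _ (hmono hmn ((hSproj m).map_mem x))

/-- A strongly convergent sequence of projections can be perturbed so that the range contains a
given finite-dimensional complemented subspace. -/
theorem exists_proj_range_ge [CompleteSpace E] {T : ℕ → E →L[𝕜] E} (hT : IsApproxSeq 𝕜 E T)
    {C : ℝ} (hC0 : 0 ≤ C) (hC : ∀ n, ‖T n‖ ≤ C) {R : E →L[𝕜] E} (hR : R * R = R)
    (hRfin : FiniteDimensional 𝕜 (LinearMap.range (R : E →ₗ[𝕜] E))) (j : ℕ) :
    ∃ R' : E →L[𝕜] E, R' * R' = R' ∧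
      FiniteDimensional 𝕜 (LinearMap.range (R' : E →ₗ[𝕜] E)) ∧ R' * R = R ∧ ‖R'‖ ≤ 4 * C ∧
      ∃ n ≥ j, ∀ x, ‖R' x - x‖ ≤ 2 * (‖T n x - x‖ + (C + 1) * ((1 / (j + 1)) * ‖x‖)) := by
  have h1 := tendsto_norm_sub_one_mul hT.tendsto_apply
    (LinearMap.range (R : E →ₗ[𝕜] E)) (R := R) (fun x => ⟨x, rfl⟩)
  obtain ⟨n, ⟨hn2, hnj⟩, hn⟩ := (((h1.eventually_le_const (u := 1 / 2) (by norm_num)).and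
    (h1.eventually_le_const (u := 1 / ((j : ℝ) + 1)) (by positivity))).and
    (eventually_ge_atTop j)).exists
  obtain ⟨B, hAB, hBA, hB⟩ := exists_inverse_of_near_one (A := 1 + (T n - 1) * R)
    (by simpa using hn2)
  have hTn : T n * T n = T n := hT.idem n
  have hAR : (1 + (T n - 1) * R) * R = T n * R := by
    rw [add_mul, mul_assoc, hR]; noncomm_ring
  have hA1 : ‖(1 + (T n - 1) * R) - 1‖ ≤ 1 / (j + 1) := by simpa using hnj
  have hA2 : ‖1 + (T n - 1) * R‖ ≤ 2 := by
    refine (norm_add_le _ _).trans ?_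
    have : ‖(1 : E →L[𝕜] E)‖ ≤ 1 := ContinuousLinearMap.norm_id_le
    linarith
  generalize 1 + (T n - 1) * R = A at *
  -- Conjugation by `A`: since `A * R = T n * R`, the range of `R` is carried into that of `T n`,
  -- hence fixed by the conjugate. The bound `4 * C` does not involve `R`, so iteration loses
  -- nothing.
  refine ⟨B * T n * A, ?_, ?_, ?_, ?_, n, hn, fun x => ?_⟩
  · calc B * T n * A * (B * T n * A) = B * T n * (A * B) * T n * A := by noncomm_ring
      _ = B * (T n * T n) * A := by rw [hAB]; noncomm_ring
      _ = B * T n * A := by rw [hTn]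
  · have := hT.finiteRank n
    refine Submodule.finiteDimensional_of_le
      (S₂ := (LinearMap.range (T n : E →ₗ[𝕜] E)).map (B : E →ₗ[𝕜] E)) ?_
    rintro _ ⟨x, rfl⟩
    exact ⟨T n (A x), ⟨A x, rfl⟩, rfl⟩
  · calc B * T n * A * R = B * (T n * T n * R) := by rw [mul_assoc, hAR]; noncomm_ring
      _ = B * A * R := by rw [hTn, ← hAR, mul_assoc]
      _ = R := by rw [hBA, one_mul]
  · calc ‖B * T n * A‖ ≤ 2 * C * 2 :=
          (norm_mul_le _ _).trans (mul_le_mul ((norm_mul_le _ _).trans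
            (mul_le_mul hB (hC _) (norm_nonneg _) (by norm_num))) hA2 (norm_nonneg _)
            (by positivity))
      _ = 4 * C := by ring
  · have hx : B (A x) = x := congrArg (fun S : E →L[𝕜] E => S x) hBA
    have e1 : (B * T n * A) x - x = B (T n (A x) - A x) := by
      rw [map_sub, hx]; rfl
    have e2 : T n (A x) - A x = (T n x - x) + (T n - 1) ((A - 1) x) := by
      simp only [sub_apply, one_apply_eq_self, map_sub]
      abel
    have h3 : ‖T n - 1‖ ≤ C + 1 := (norm_sub_le _ _).trans
      (add_le_add (hC n) ContinuousLinearMap.norm_id_le)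
    have h4 : ‖(T n - 1) ((A - 1) x)‖ ≤ (C + 1) * (1 / (j + 1) * ‖x‖) :=
      ((T n - 1).le_of_opNorm_le h3 _).trans
        (mul_le_mul_of_nonneg_left ((A - 1).le_of_opNorm_le hA1 x) (by positivity))
    rw [e1]
    refine (B.le_of_opNorm_le hB _).trans ?_
    rw [e2]
    gcongr
    exact (norm_add_le _ _).trans (by gcongr)

/-- The `π`-property is witnessed by projections with increasing ranges. -/
theorem HasPiProperty.exists_chain [CompleteSpace E] (hE : HasPiProperty 𝕜 E) :
    ∃ (X : ℕ → Submodule 𝕜 E) (Q : ℕ → E →L[𝕜] E) (C : ℝ), Monotone X ∧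
      (∀ i, FiniteDimensional 𝕜 (X i)) ∧ (∀ i, LinearMap.IsProj (X i) (Q i)) ∧
      (∀ i, ‖Q i‖ ≤ C) ∧ Dense (⋃ i, (X i : Set E)) := by
  obtain ⟨T, hT⟩ := hE
  obtain ⟨C, hC0, hC⟩ := hT.exists_bound
  let F := {R : E →L[𝕜] E // R * R = R ∧ FiniteDimensional 𝕜 (LinearMap.range (R : E →ₗ[𝕜] E))}
  have hstep : ∀ (R : F) (j : ℕ), ∃ R' : F, R'.1 * R.1 = R.1 ∧ ‖R'.1‖ ≤ 4 * C ∧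
      ∃ n ≥ j, ∀ x, ‖R'.1 x - x‖ ≤ 2 * (‖T n x - x‖ + (C + 1) * ((1 / (j + 1)) * ‖x‖)) := by
    intro R j
    obtain ⟨R', h1, h2, h3⟩ := exists_proj_range_ge hT hC0 hC R.2.1 R.2.2 j
    exact ⟨⟨R', h1, h2⟩, h3⟩
  choose f hf1 hf2 hf3 using hstep
  let s : ℕ → F := fun n => Nat.rec ⟨T 0, hT.idem 0, hT.finiteRank 0⟩ (fun j R => f R j) n
  have hs1 : ∀ j, (s (j + 1)).1 * (s j).1 = (s j).1 := fun j => hf1 _ _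
  have hs2 : ∀ j, ‖(s (j + 1)).1‖ ≤ 4 * C := fun j => hf2 _ _
  have hs3 : ∀ x, Tendsto (fun j => (s (j + 1)).1 x) atTop (𝓝 x) := by
    intro x
    have hs : ∀ j, ∃ n ≥ j, ∀ x, ‖(s (j + 1)).1 x - x‖ ≤
        2 * (‖T n x - x‖ + (C + 1) * ((1 / (j + 1)) * ‖x‖)) := fun j => hf3 _ _
    choose ν hν hν' using hs
    have hν2 : Tendsto ν atTop atTop := tendsto_atTop_mono hν tendsto_id
    rw [tendsto_iff_norm_sub_tendsto_zero]
    refine squeeze_zero (fun _ => norm_nonneg _) (fun j => hν' j x) ?_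
    have l1 := (tendsto_iff_norm_sub_tendsto_zero.1 (hT.tendsto_apply x)).comp hν2
    have l2 := ((tendsto_one_div_add_atTop_nhds_zero_nat (𝕜 := ℝ)).mul_const ‖x‖).const_mul (C + 1)
    simpa using (l1.add l2).const_mul 2
  -- The shift drops the starting projection `T 0`, which is not an output of the perturbation step.
  refine ⟨fun i => LinearMap.range ((s (i + 1)).1 : E →ₗ[𝕜] E), fun i => (s (i + 1)).1, 4 * C,
    monotone_nat_of_le_succ fun i => ?_, fun i => (s (i + 1)).2.2,
    fun i => isProj_range (s (i + 1)).2.1, fun i => hs2 i, fun x => ?_⟩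
  · rintro _ ⟨x, rfl⟩
    exact ⟨(s (i + 1)).1 x, congrArg (fun S : E →L[𝕜] E => S x) (hs1 (i + 1))⟩
  · exact mem_closure_of_tendsto (hs3 x)
      (Eventually.of_forall fun j => Set.mem_iUnion.2 ⟨j, x, rfl⟩)

end Construction

end BanachProj

theorem theorem1 {𝕜 : Type*} [RCLike 𝕜] {E : Type*} [NormedAddCommGroup E] [NormedSpace 𝕜 E]
    [CompleteSpace E] [TopologicalSpace.SeparableSpace E] :
    (HasPiProperty 𝕜 E ∧ ¬ HasFDD 𝕜 E) ↔
      ∃ X : ℕ → Submodule 𝕜 E, Monotone X ∧ (∀ i, FiniteDimensional 𝕜 (X i)) ∧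
        (⨆ i, relProjConst (X i)) < ∞ ∧
        closure (⋃ i, (X i : Set E)) = Set.univ ∧
        ∀ φ : ℕ → ℕ, StrictMono φ →
          ∀ P : ∀ n, X (φ (n + 1)) →L[𝕜] X (φ n), (∀ n, IsProjection (P n)) →
            (⨆ (k : ℕ) (l : ℕ) (_ : k < l),
              ‖compProj (W := fun n => X (φ n)) P k (l - k)‖ₑ) = ∞ := by
  constructor
  · rintro ⟨hpi, hfdd⟩
    obtain ⟨X, Q, C, hmono, hfin, hQ, hC, hdense⟩ := hpi.exists_chain
    refine ⟨X, hmono, hfin, iSup_relProjConst_lt_top hQ hC, hdense.closure_eq, ?_⟩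
    intro φ hφ P hP
    by_contra hne
    set a := ⨆ (k : ℕ) (l : ℕ) (_ : k < l),
      ‖compProj (W := fun n => X (φ n)) P k (l - k)‖ₑ with ha
    have hdense' : Dense (⋃ n, (X (φ n) : Set E)) := by
      refine hdense.mono (Set.iUnion_subset fun i => ?_)
      exact Set.subset_iUnion_of_subset i (hmono (hφ.id_le i))
    refine hfdd (hasFDD_of_compProj_bounded (W := fun n => X (φ n)) (hmono.comp hφ.monotone)
      hdense' (fun n => hQ (φ n)) (fun n => hC (φ n)) hP
      (M := a.toReal) ENNReal.toReal_nonneg fun k m => ?_)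
    have hle := le_iSup_of_le (f := fun k => ⨆ (l : ℕ) (_ : k < l),
      ‖compProj (W := fun n => X (φ n)) P k (l - k)‖ₑ) k
      (le_iSup₂_of_le (k + (m + 1)) (by omega) le_rfl)
    rw [Nat.add_sub_cancel_left, ← ha] at hle
    have := ENNReal.toReal_mono hne hle
    rwa [toReal_enorm] at this
  · rintro ⟨X, hmono, hfin, hlam, hcl, h⟩
    obtain ⟨Q, C, hQX, hC⟩ := exists_isProj_of_relProjConst hlam
    have hQ := isApproxSeq_of_isProj hmono hfin (dense_iff_closure_eq.2 hcl) hQX hC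
    exact ⟨⟨Q, hQ⟩, not_hasFDD_of_chain hQX hQ h⟩
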